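/- Let $d\ge 1$. Consider a weighted lattice graph on $V=\mathbb Z^d$: symmetric weights $w_{xy}=w_{yx}\ge 0$ such that, for $x\ne y$, $w_{xy}>0$ if $\sum_i|x_i-y_i|=1$ and $w_{xy}=0$ otherwise (a loop weight $w_{xx}\ge 0$ is allowed, and may be zero), with the normalizing vertex measure $\mu(x)=\sum_{y}w_{xy}$, and assume $$0<\inf_{x\in\mathbb Z^d}\mu(x)\le \sup_{x\in\mathbb Z^d}\mu(x)<\infty .$$ Let $\Delta f(x)=\frac1{\mu(x)}\sum_{y}w_{xy}\,(f(y)-f(x))$ be the normalized Laplacian; $-\Delta$ is a bounded positive self-adjoint operator on $\ell^2(\mathbb Z^d,\mu)$. Let $E$ be its spectral measure, and define $$(-\Delta)^s=\int_{[0,\infty)}\lambda^s\,dE(\lambda),\qquad e^{t\Delta}=\int_{[0,\infty)}e^{-t\lambda}\,dE(\lambda),\qquad p(t,x,y)=\frac{\langle \mathbf 1_{\{x\}},e^{t\Delta}\mathbf 1_{\{y\}}\rangle_{\ell^2(\mathbb Z^d,\mu)}}{\mu(x)\mu(y)} .$$ Then for every finitely supported $u:\mathbb Z^d\to\mathbb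 R$ and every $x\in\mathbb Z^d$, $$\lim_{s\to0^+}(-\Delta)^su(x)=u(x).$$ The same holds for the fractional Laplacian given by its pointwise kernel formula: for every $0<s<1$ the integrals $$W_s(x,y)=\frac{s}{\Gamma(1-s)}\,\mu(x)\mu(y)\int_0^\infty p(t,x,y)\,t^{-1-s}\,dt\qquad(y\ne x)$$ converge, the series $\sum_{y\ne x}W_s(x,y)(u(x)-u(y))$ converges absolutely, and $$\lim_{s\to0^+}\ \frac1{\mu(x)}\sum_{y\ne x}W_s(x,y)\,\bigl(u(x)-u(y)\bigr)=u(x).$$ -/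

import Mathlib

open MeasureTheory Filter Topology
open scoped ENNReal

noncomputable section

/-- `φ(A) = ∫ φ(λ) dE(λ)` for a real function `φ` and a bounded self-adjoint operator `A` on a
complex Hilbert space. -/
def functionOfOperator {H : Type*} [NormedAddCommGroup H] [InnerProductSpace ℂ H]
    [CompleteSpace H] (φ : ℝ → ℝ) (A : H →L[ℂ] H) : H →L[ℂ] H :=
  cfc (p := IsSelfAdjoint) φ A

/-- Two points of `ℤ^d` are neighbours when their `ℓ¹`-distance is `1`. -/
def LatticeAdj {d : ℕ} (x y : Fin d → ℤ) : Prop := ∑ i, |x i - y i| = 1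

/-- A weighted lattice graph on `ℤ^d` with the normalizing vertex measure `μ(x) = ∑_y w_{xy}`:
the weights are symmetric, positive exactly along the lattice edges (a loop weight `w_{xx} ≥ 0`
is allowed, and may vanish), and the vertex measure is bounded away from `0` and from `∞`. -/
structure WeightedLattice (d : ℕ) where
  /-- the edge weights -/
  w : (Fin d → ℤ) → (Fin d → ℤ) → ℝ
  symm : ∀ x y, w x y = w y x
  pos_of_adj : ∀ x y, LatticeAdj x y → 0 < w x y
  eq_zero_of_not_adj : ∀ x y, x ≠ y → ¬ LatticeAdj x y → w x y = 0
  loop_nonneg : ∀ x, 0 ≤ w x x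
  inf_pos : ∃ c : ℝ, 0 < c ∧ ∀ x, c ≤ ∑' y, w x y
  sup_lt_top : ∃ C : ℝ, ∀ x, ∑' y, w x y ≤ C

namespace WeightedLattice

variable {d : ℕ} (G : WeightedLattice d)

/-- The vertex measure `μ(x) = m(x) = ∑_y w_{xy}`, of the normalized Laplacian. -/
def μ (x : Fin d → ℤ) : ℝ := ∑' y, G.w x y

/-- The measure on `ℤ^d` that gives the point `x` the mass `μ(x)`. -/
def vol : Measure (Fin d → ℤ) :=
  Measure.sum fun x => ENNReal.ofReal (G.μ x) • Measure.dirac x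

/-- The complex Hilbert space `ℓ²(ℤ^d, μ)`. -/
abbrev L2 := Lp ℂ 2 G.vol

/-- The formal Laplacian `Δf(x) = μ(x)⁻¹ ∑_y w_{xy} (f(y) - f(x))`. -/
def lap (f : (Fin d → ℤ) → ℂ) (x : Fin d → ℤ) : ℂ :=
  ((G.μ x : ℝ) : ℂ)⁻¹ * ∑' y, ((G.w x y : ℝ) : ℂ) * (f y - f x)

theorem μ_pos (x : Fin d → ℤ) : 0 < G.μ x := by
  obtain ⟨c, hc, h⟩ := G.inf_pos
  exact hc.trans_le (h x)

theorem w_nonneg (x y : Fin d → ℤ) : 0 ≤ G.w x y := by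
  by_cases hxy : x = y
  · subst hxy; exact G.loop_nonneg x
  · by_cases h : LatticeAdj x y
    · exact (G.pos_of_adj x y h).le
    · exact (G.eq_zero_of_not_adj x y hxy h).ge

theorem w_eq_zero_of_notMem (x y : Fin d → ℤ) (hy : y ∉ Finset.Icc (x - 1) (x + 1)) :
    G.w x y = 0 := by
  apply G.eq_zero_of_not_adj
  · rintro rfl
    apply hy
    rw [Finset.mem_Icc]
    constructor <;> intro i <;> simp
  · intro h
    apply hy
    have key : ∀ i, |x i - y i| ≤ 1 := fun i => by
      rw [← h]
      exact Finset.single_le_sum (f := fun i => |x i - y i|) (fun j _ => abs_nonneg _)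
        (Finset.mem_univ i)
    rw [Finset.mem_Icc]
    constructor <;> intro i <;> have := abs_le.1 (key i) <;> simp <;> omega

theorem lap_eq_sum (f : (Fin d → ℤ) → ℂ) (x : Fin d → ℤ) :
    G.lap f x = ((G.μ x : ℝ) : ℂ)⁻¹ *
      ∑ y ∈ Finset.Icc (x - 1) (x + 1), ((G.w x y : ℝ) : ℂ) * (f y - f x) := by
  unfold lap
  rw [tsum_eq_sum]
  intro y hy
  simp [G.w_eq_zero_of_notMem x y hy]

theorem μ_eq_sum (x : Fin d → ℤ) :
    G.μ x = ∑ y ∈ Finset.Icc (x - 1) (x + 1), G.w x y :=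
  tsum_eq_sum fun y hy => G.w_eq_zero_of_notMem x y hy

theorem ofReal_μ (x : Fin d → ℤ) :
    ENNReal.ofReal (G.μ x) = ∑' y, ENNReal.ofReal (G.w x y) := by
  rw [G.μ_eq_sum, ENNReal.ofReal_sum_of_nonneg fun y _ => G.w_nonneg x y, tsum_eq_sum]
  intro y hy
  simp [G.w_eq_zero_of_notMem x y hy]

theorem vol_singleton (x : Fin d → ℤ) : G.vol {x} = ENNReal.ofReal (G.μ x) := by
  rw [vol, Measure.sum_apply _ (measurableSet_singleton x), tsum_eq_single x]
  · simp
  · intro y hy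
    simp [hy]

theorem vol_singleton_ne_top (x : Fin d → ℤ) : G.vol {x} ≠ ∞ := by
  simp [vol_singleton]

/-- Every point has positive mass, so elements of `ℓ²(ℤ^d, μ)` are genuine functions. -/
theorem forall_of_ae {p : (Fin d → ℤ) → Prop} (h : ∀ᵐ x ∂G.vol, p x) (x : Fin d → ℤ) : p x := by
  by_contra hx
  have h0 : G.vol {x} = 0 := measure_mono_null (by simpa using hx) (ae_iff.1 h)
  rw [vol_singleton, ENNReal.ofReal_eq_zero] at h0
  exact absurd (G.μ_pos x) (not_lt.2 h0)

theorem eLpNorm_sq (f : (Fin d → ℤ) → ℂ) :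
    eLpNorm f 2 G.vol ^ 2 = ∑' x, ENNReal.ofReal (G.μ x) * ‖f x‖ₑ ^ 2 := by
  have h2 := eLpNorm_nnreal_pow_eq_lintegral (μ := G.vol) (f := f) (p := 2) (by norm_num)
  have h3 : eLpNorm f 2 G.vol ^ 2 = ∫⁻ x, ‖f x‖ₑ ^ 2 ∂G.vol := by
    simpa using h2
  rw [h3, vol, lintegral_sum_measure]
  refine tsum_congr fun x => ?_
  rw [lintegral_smul_measure, lintegral_dirac, smul_eq_mul]

theorem lap_sq_le (f : (Fin d → ℤ) → ℂ) (x : Fin d → ℤ) :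
    G.μ x * ‖G.lap f x‖ ^ 2 ≤
      ∑ y ∈ Finset.Icc (x - 1) (x + 1), G.w x y * (2 * ‖f y‖ ^ 2 + 2 * ‖f x‖ ^ 2) := by
  have hμ := G.μ_pos x
  set N := Finset.Icc (x - 1) (x + 1)
  set S := ∑ y ∈ N, ((G.w x y : ℝ) : ℂ) * (f y - f x) with hS
  have h1 : ‖S‖ ^ 2 ≤ G.μ x * ∑ y ∈ N, G.w x y * ‖f y - f x‖ ^ 2 := by
    have h2 : ‖S‖ ≤ ∑ y ∈ N, G.w x y * ‖f y - f x‖ := by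
      refine (norm_sum_le _ _).trans (Finset.sum_le_sum fun y _ => ?_)
      rw [norm_mul, Complex.norm_real, Real.norm_of_nonneg (G.w_nonneg x y)]
    have h3 : (∑ y ∈ N, G.w x y * ‖f y - f x‖) ^ 2 ≤
        (∑ y ∈ N, G.w x y) * ∑ y ∈ N, G.w x y * ‖f y - f x‖ ^ 2 := by
      refine Finset.sum_sq_le_sum_mul_sum_of_sq_le_mul N (fun y _ => G.w_nonneg x y)
        (fun y _ => mul_nonneg (G.w_nonneg x y) (sq_nonneg _)) (fun y _ => le_of_eq (by ring))
    rw [G.μ_eq_sum]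
    exact (pow_le_pow_left₀ (norm_nonneg _) h2 2).trans h3
  rw [G.lap_eq_sum, norm_mul, norm_inv, Complex.norm_real, Real.norm_of_nonneg hμ.le]
  have h4 : G.μ x * ((G.μ x)⁻¹ * ‖S‖) ^ 2 = (G.μ x)⁻¹ * ‖S‖ ^ 2 := by
    field_simp
  rw [h4]
  calc (G.μ x)⁻¹ * ‖S‖ ^ 2
      ≤ (G.μ x)⁻¹ * (G.μ x * ∑ y ∈ N, G.w x y * ‖f y - f x‖ ^ 2) := by gcongr
    _ = ∑ y ∈ N, G.w x y * ‖f y - f x‖ ^ 2 := by field_simp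
    _ ≤ _ := by
      refine Finset.sum_le_sum fun y _ => mul_le_mul_of_nonneg_left ?_ (G.w_nonneg x y)
      have h5 := norm_sub_le (f y) (f x)
      have h6 := norm_nonneg (f y - f x)
      nlinarith [sq_nonneg (‖f y‖ - ‖f x‖)]

theorem lap_sq_le_tsum (f : (Fin d → ℤ) → ℂ) (x : Fin d → ℤ) :
    ENNReal.ofReal (G.μ x) * ‖G.lap f x‖ₑ ^ 2 ≤
      ∑' y, ENNReal.ofReal (G.w x y) * (2 * ‖f y‖ₑ ^ 2 + 2 * ‖f x‖ₑ ^ 2) := by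
  have h := ENNReal.ofReal_le_ofReal (G.lap_sq_le f x)
  rw [ENNReal.ofReal_mul (G.μ_pos x).le, ENNReal.ofReal_pow (norm_nonneg _), ofReal_norm,
    ENNReal.ofReal_sum_of_nonneg fun y _ => mul_nonneg (G.w_nonneg x y) (by positivity)] at h
  refine h.trans (le_trans (le_of_eq ?_) (ENNReal.sum_le_tsum (Finset.Icc (x - 1) (x + 1))))
  refine Finset.sum_congr rfl fun y _ => ?_
  rw [ENNReal.ofReal_mul (G.w_nonneg x y), ENNReal.ofReal_add (by positivity) (by positivity),
    ENNReal.ofReal_mul (by norm_num), ENNReal.ofReal_mul (by norm_num),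
    ENNReal.ofReal_pow (norm_nonneg _), ENNReal.ofReal_pow (norm_nonneg _), ofReal_norm,
    ofReal_norm]
  simp

theorem eLpNorm_lap_le (f : (Fin d → ℤ) → ℂ) :
    eLpNorm (G.lap f) 2 G.vol ≤ 2 * eLpNorm f 2 G.vol := by
  have h : eLpNorm (G.lap f) 2 G.vol ^ 2 ≤ (2 * eLpNorm f 2 G.vol) ^ 2 := by
    rw [mul_pow, eLpNorm_sq, eLpNorm_sq]
    have hA : ∑' x, ∑' y, ENNReal.ofReal (G.w x y) * (2 * ‖f x‖ₑ ^ 2) =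
        2 * ∑' x, ENNReal.ofReal (G.μ x) * ‖f x‖ₑ ^ 2 := by
      rw [← ENNReal.tsum_mul_left]
      refine tsum_congr fun x => ?_
      rw [ENNReal.tsum_mul_right, ← G.ofReal_μ]
      ring
    have hB : ∑' x, ∑' y, ENNReal.ofReal (G.w x y) * (2 * ‖f y‖ₑ ^ 2) =
        2 * ∑' x, ENNReal.ofReal (G.μ x) * ‖f x‖ₑ ^ 2 := by
      rw [ENNReal.tsum_comm, ← hA]
      refine tsum_congr fun x => tsum_congr fun y => ?_
      rw [G.symm]
    calc ∑' x, ENNReal.ofReal (G.μ x) * ‖G.lap f x‖ₑ ^ 2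
        ≤ ∑' x, ∑' y, ENNReal.ofReal (G.w x y) * (2 * ‖f y‖ₑ ^ 2 + 2 * ‖f x‖ₑ ^ 2) :=
          ENNReal.tsum_le_tsum fun x => G.lap_sq_le_tsum f x
      _ = 2 ^ 2 * ∑' x, ENNReal.ofReal (G.μ x) * ‖f x‖ₑ ^ 2 := by
          simp_rw [mul_add, ENNReal.tsum_add]
          rw [hA, hB]
          ring
  exact (ENNReal.pow_le_pow_left_iff two_ne_zero).1 h

theorem memLp_neg_lap (f : G.L2) : MemLp (fun x => - G.lap f x) 2 G.vol := by
  refine MemLp.neg (f := G.lap f) ⟨(measurable_of_countable _).aestronglyMeasurable, ?_⟩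
  exact (G.eLpNorm_lap_le f).trans_lt
    (ENNReal.mul_lt_top (by simp) (Lp.eLpNorm_lt_top f))

theorem lap_add (f g : (Fin d → ℤ) → ℂ) (x : Fin d → ℤ) :
    G.lap (f + g) x = G.lap f x + G.lap g x := by
  simp only [lap_eq_sum, ← mul_add, ← Finset.sum_add_distrib, Pi.add_apply]
  congr 1
  exact Finset.sum_congr rfl fun y _ => by ring

theorem lap_smul (c : ℂ) (f : (Fin d → ℤ) → ℂ) (x : Fin d → ℤ) :
    G.lap (c • f) x = c * G.lap f x := by
  simp only [lap_eq_sum, Finset.mul_sum, Pi.smul_apply, smul_eq_mul]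
  exact Finset.sum_congr rfl fun y _ => by ring

/-- The positive bounded self-adjoint operator `-Δ` on `ℓ²(ℤ^d, μ)`. -/
def negLaplacian : G.L2 →L[ℂ] G.L2 :=
  LinearMap.mkContinuous
    { toFun := fun f => (G.memLp_neg_lap f).toLp (fun x => - G.lap f x)
      map_add' := fun f g => by
        apply Lp.ext
        filter_upwards [(G.memLp_neg_lap (f + g)).coeFn_toLp,
          Lp.coeFn_add ((G.memLp_neg_lap f).toLp _) ((G.memLp_neg_lap g).toLp _),
          (G.memLp_neg_lap f).coeFn_toLp, (G.memLp_neg_lap g).coeFn_toLp] with x h1 h2 h3 h4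
        have h5 : ((f + g : G.L2) : (Fin d → ℤ) → ℂ) = f + g :=
          funext fun y => G.forall_of_ae (Lp.coeFn_add f g) y
        rw [h1, h2, Pi.add_apply, h3, h4, h5, G.lap_add]
        ring
      map_smul' := fun c f => by
        apply Lp.ext
        filter_upwards [(G.memLp_neg_lap (c • f)).coeFn_toLp,
          Lp.coeFn_smul c ((G.memLp_neg_lap f).toLp _),
          (G.memLp_neg_lap f).coeFn_toLp] with x h1 h2 h3
        have h5 : ((c • f : G.L2) : (Fin d → ℤ) → ℂ) = c • ⇑f :=
          funext fun y => G.forall_of_ae (Lp.coeFn_smul c f) y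
        simp only [RingHom.id_apply]
        rw [h1, h2, Pi.smul_apply, h3, h5, G.lap_smul, smul_eq_mul]
        ring }
    2 (fun f => by
      change ‖(G.memLp_neg_lap f).toLp (fun x => - G.lap f x)‖ ≤ 2 * ‖f‖
      rw [Lp.norm_toLp, Lp.norm_def]
      have h : eLpNorm (fun x => - G.lap f x) 2 G.vol = eLpNorm (G.lap f) 2 G.vol :=
        eLpNorm_neg (G.lap f) 2 G.vol
      rw [h]
      have h2 := ENNReal.toReal_mono (ENNReal.mul_ne_top (by simp) (Lp.eLpNorm_ne_top f))
        (G.eLpNorm_lap_le f)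
      simpa using h2)

theorem negLaplacian_apply (f : G.L2) (x : Fin d → ℤ) :
    (G.negLaplacian f : (Fin d → ℤ) → ℂ) x = - G.lap f x :=
  G.forall_of_ae (G.memLp_neg_lap f).coeFn_toLp x

/-- The indicator function of the vertex `x`, in `ℓ²(ℤ^d, μ)`. -/
def pointMass (x : Fin d → ℤ) : G.L2 :=
  indicatorConstLp 2 (measurableSet_singleton x) (G.vol_singleton_ne_top x) (1 : ℂ)

theorem inner_pointMass (x : Fin d → ℤ) (f : G.L2) :
    inner ℂ (G.pointMass x) f = (G.μ x : ℂ) * f x := by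
  rw [pointMass, L2.inner_indicatorConstLp_one, integral_singleton, Measure.real, vol_singleton,
    ENNReal.toReal_ofReal (G.μ_pos x).le]
  simp

theorem pointMass_apply (x y : Fin d → ℤ) :
    (G.pointMass x : (Fin d → ℤ) → ℂ) y = if y = x then 1 else 0 := by
  rw [G.forall_of_ae (p := fun y => G.pointMass x y = Set.indicator {x} (fun _ => (1 : ℂ)) y)
    indicatorConstLp_coeFn y]
  simp [Set.indicator_apply]

theorem ext_of_inner {f g : G.L2}
    (h : ∀ x, inner ℂ (G.pointMass x) f = inner ℂ (G.pointMass x) g) : f = g := by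
  apply Lp.ext
  refine Eventually.of_forall fun x => ?_
  have := h x
  rw [inner_pointMass, inner_pointMass] at this
  exact mul_left_cancel₀ (by exact_mod_cast (G.μ_pos x).ne') this

theorem inner_negLaplacian_pointMass (x y : Fin d → ℤ) :
    inner ℂ (G.pointMass x) (G.negLaplacian (G.pointMass y)) =
      (((if x = y then G.μ x else 0) - G.w x y : ℝ) : ℂ) := by
  have hμ : (G.μ x : ℂ) ≠ 0 := by exact_mod_cast (G.μ_pos x).ne'
  rw [inner_pointMass, negLaplacian_apply, lap_eq_sum, mul_neg, mul_inv_cancel_left₀ hμ]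
  simp only [pointMass_apply, mul_sub, Finset.sum_sub_distrib, mul_ite, mul_one, mul_zero,
    Finset.sum_ite_eq']
  have h1 : (if y ∈ Finset.Icc (x - 1) (x + 1) then (G.w x y : ℂ) else 0) = G.w x y := by
    split_ifs with h
    · rfl
    · simp [G.w_eq_zero_of_notMem x y h]
  rw [h1]
  split_ifs with h
  · rw [G.μ_eq_sum]; push_cast; ring
  · simp

/-- The operator `-Δ` is self-adjoint, so that its functional calculus makes sense. -/
theorem isSelfAdjoint_negLaplacian : IsSelfAdjoint G.negLaplacian := by
  have h1 : ∀ y, ContinuousLinearMap.adjoint G.negLaplacian (G.pointMass y) =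
      G.negLaplacian (G.pointMass y) := fun y => G.ext_of_inner fun x => by
    rw [ContinuousLinearMap.adjoint_inner_right, ← inner_conj_symm,
      inner_negLaplacian_pointMass, inner_negLaplacian_pointMass, Complex.conj_ofReal, G.symm y x]
    congr 2
    by_cases h : x = y
    · simp [h]
    · simp [h, Ne.symm h]
  rw [ContinuousLinearMap.isSelfAdjoint_iff']
  refine ContinuousLinearMap.ext fun f => G.ext_of_inner fun x => ?_
  rw [ContinuousLinearMap.adjoint_inner_right, ← h1, ContinuousLinearMap.adjoint_inner_left]

/-- The spectral fractional Laplacian `(-Δ)^s = ∫ λ^s dE(λ)` on `ℓ²(ℤ^d, μ)`. -/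
def fracLaplacian (s : ℝ) : G.L2 →L[ℂ] G.L2 :=
  functionOfOperator (fun l : ℝ => l ^ s) G.negLaplacian

/-- The heat semigroup `e^{tΔ} = ∫ e^{-tλ} dE(λ)` on `ℓ²(ℤ^d, μ)`. -/
def heatSemigroup (t : ℝ) : G.L2 →L[ℂ] G.L2 :=
  functionOfOperator (fun l : ℝ => Real.exp (-t * l)) G.negLaplacian

/-- The heat kernel `p(t,x,y) = ⟨1_x, e^{tΔ} 1_y⟩ / (μ(x) μ(y))`
(the inner product is a real number). -/
def heatKernel (t : ℝ) (x y : Fin d → ℤ) : ℝ :=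
  1 / (G.μ x * G.μ y) * (inner ℂ (G.pointMass x) (G.heatSemigroup t (G.pointMass y))).re

/-- The fractional weight `W_s(x,y) = s / Γ(1-s) μ(x) μ(y) ∫₀^∞ p(t,x,y) t^{-1-s} dt`. -/
def fracWeight (s : ℝ) (x y : Fin d → ℤ) : ℝ :=
  s / Real.Gamma (1 - s) * G.μ x * G.μ y *
    ∫ t in Set.Ioi (0 : ℝ), G.heatKernel t x y * t ^ (-1 - s)

/-- The pointwise fractional Laplacian `μ(x)⁻¹ ∑_{y ≠ x} W_s(x,y) (u(x) - u(y))`. -/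
def fracLaplacianPointwise (s : ℝ) (u : (Fin d → ℤ) → ℝ) (x : Fin d → ℤ) : ℝ :=
  1 / G.μ x * ∑' y : {y // y ≠ x}, G.fracWeight s x y * (u x - u y)

theorem memLp_finsupp (u : (Fin d → ℤ) →₀ ℝ) : MemLp (fun x => (u x : ℂ)) 2 G.vol := by
  refine ⟨(measurable_of_countable _).aestronglyMeasurable, ?_⟩
  have h : eLpNorm (fun x => (u x : ℂ)) 2 G.vol ^ 2 < ∞ := by
    rw [eLpNorm_sq, tsum_eq_sum (s := u.support)]
    · refine ENNReal.sum_lt_top.2 fun x _ => ENNReal.mul_lt_top (by simp) ?_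
      exact ENNReal.pow_lt_top (by simp)
    · intro x hx
      simp [Finsupp.notMem_support_iff.1 hx]
  simpa using h

/-- A finitely supported real function, as an element of `ℓ²(ℤ^d, μ)`. -/
def toL2 (u : (Fin d → ℤ) →₀ ℝ) : G.L2 := (G.memLp_finsupp u).toLp (fun x => (u x : ℂ))

end WeightedLattice

end

/-! Both limits rest on one fact: `-Δ` has spectrum in `[0, 2]` and trivial kernel, so `0` carries
no spectral mass. Write `P = 1 + Δ` for the Markov operator. Weighted Cauchy–Schwarz and the
symmetry of `w` give `‖P‖ ≤ 1`, hence the spectral bound. A harmonic `ℓ²` function vanishes at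
infinity, so its modulus attains a maximum; the maximum principle spreads it along an infinite ray,
which forces the function to be `0` (`negLaplacian_injective`).

For an injective self-adjoint `A` with spectrum in `[0, 2]`, the range of `A` is dense. Thus `A ^ s
→ 1` and `exp (-t A) → 0` hold strongly once they hold in norm after multiplication by `A`, where
they reduce to the scalar bounds `|l ^ s * l - l| ≤ 2 s` and `exp (-t l) * l ≤ 1 / t`. The first
limit gives the spectral statement.

For the kernel formula, `e^{tΔ}` is the Poisson average of the powers of `P`. So its matrix `h_t(x,
y)` is nonnegative with row sums `μ(x)`, and both `h_t(x, y)` for `y ≠ x` and `μ(x) - h_t(x, x)` are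
at most `μ(x) min(1, t)`. An Abelian theorem says that `s ∫ f(t) t^{-1-s} dt` tends to the limit of
`f` at infinity. As `h_t(x, y) → 0`, each single weight `W_s(x, y)` tends to `0` while their sum
over `y ≠ x` tends to `μ(x)`: all the mass escapes to infinity, where `u` vanishes, and only `u(x)`
survives. -/

section CStarAlgebra

/-! ### The exponential of a self-adjoint element. -/

variable {𝔸 : Type*} [CStarAlgebra 𝔸] {a : 𝔸}

theorem IsSelfAdjoint.cfc_exp_neg_mul (ha : IsSelfAdjoint a) (t : ℝ) :
    cfc (p := IsSelfAdjoint) (fun l : ℝ => Real.exp (-t * l)) a = NormedSpace.exp ((-t) • a) := by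
  rw [cfc_comp_const_mul (-t) Real.exp a (by fun_prop) ha]
  exact CFC.real_exp_eq_normedSpace_exp ((IsSelfAdjoint.all (-t)).smul ha)

theorem IsSelfAdjoint.continuous_cfc_exp (ha : IsSelfAdjoint a) :
    Continuous fun t : ℝ => cfc (p := IsSelfAdjoint) (fun l : ℝ => Real.exp (-t * l)) a := by
  simp_rw [ha.cfc_exp_neg_mul]
  let _ : NormedAlgebra ℚ 𝔸 := NormedAlgebra.restrictScalars ℚ ℝ 𝔸
  exact NormedSpace.exp_continuous.comp (by fun_prop)

/-- The scalar `-t` splits off the exponent `-t a = -t + t (1 - a)`. With `1 - a = P` this is a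
Poisson average of powers of `P`, whose coefficients are nonnegative for `t ≥ 0`; positivity and
conservation of mass for `P` thereby pass to the semigroup. -/
theorem IsSelfAdjoint.hasSum_cfc_exp (ha : IsSelfAdjoint a) (t : ℝ) :
    HasSum (fun n : ℕ => (Real.exp (-t) * (t ^ n / n.factorial)) • (1 - a) ^ n)
      (cfc (p := IsSelfAdjoint) (fun l : ℝ => Real.exp (-t * l)) a) := by
  have h1 : cfc (p := IsSelfAdjoint) (fun l : ℝ => Real.exp (-t * l)) a =
      Real.exp (-t) • NormedSpace.exp (t • (1 - a)) := by
    let _ : NormedAlgebra ℚ 𝔸 := NormedAlgebra.restrictScalars ℚ ℝ 𝔸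
    have h2 : (-t) • a = algebraMap ℝ 𝔸 (-t) + t • (1 - a) := by
      rw [Algebra.algebraMap_eq_smul_one, smul_sub, neg_smul, neg_smul]; abel
    rw [ha.cfc_exp_neg_mul, h2, NormedSpace.exp_add_of_commute (Algebra.commutes _ _),
      ← NormedSpace.algebraMap_exp_comm, ← Real.exp_eq_exp_ℝ, Algebra.smul_def (Real.exp (-t))]
  rw [h1]
  convert (NormedSpace.exp_series_hasSum_exp' (𝕂 := ℝ) (t • (1 - a))).const_smul (Real.exp (-t))
    using 2 with n
  rw [smul_pow, smul_smul, smul_smul]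
  congr 1
  ring

end CStarAlgebra

/-! ### Strong limits of functions of a bounded self-adjoint operator. -/

section BoundedOperators

variable {H : Type*} [NormedAddCommGroup H] [InnerProductSpace ℂ H] [CompleteSpace H]

theorem spectrum_subset_Icc_of_norm_one_sub_le {A : H →L[ℂ] H} (hA : ‖1 - A‖ ≤ 1) :
    spectrum ℝ A ⊆ Set.Icc 0 2 := by
  intro l hl
  have h1 : (1 - l) ∈ spectrum ℝ (1 - A) := by
    have h := spectrum.singleton_sub_eq A (1 : ℝ)
    rw [map_one] at h
    rw [← h]
    exact Set.sub_mem_sub rfl hl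
  have h2 := spectrum.norm_le_norm_mul_of_mem h1
  -- Only an inequality, because `H` may be trivial.
  have h3 : ‖(1 : H →L[ℂ] H)‖ ≤ 1 := ContinuousLinearMap.norm_id_le
  have h4 : ‖1 - l‖ ≤ 1 :=
    h2.trans (mul_le_one₀ hA (norm_nonneg _) h3)
  rw [Real.norm_eq_abs, abs_le] at h4
  constructor <;> linarith

/-- The orthogonal complement of the range is the kernel of the adjoint, here `A` itself. -/
theorem IsSelfAdjoint.denseRange_of_injective {A : H →L[ℂ] H} (hA : IsSelfAdjoint A)
    (hker : ∀ v, A v = 0 → v = 0) : DenseRange A := by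
  have h := ContinuousLinearMap.orthogonal_range A
  rw [hA.adjoint_eq] at h
  have h2 : ((A : H →ₗ[ℂ] H)).ker = ⊥ := LinearMap.ker_eq_bot'.2 hker
  rw [h2, ← Submodule.topologicalClosure_eq_top_iff, ← Submodule.dense_iff_topologicalClosure_eq_top]
    at h
  exact h

omit [CompleteSpace H] in
/-- Strong convergence of a bounded family of operators follows from norm convergence after
composition with an operator of dense range. -/
theorem tendsto_apply_of_tendsto_mul {ι : Type*} {l : Filter ι} {T : ι → H →L[ℂ] H}
    {A L : H →L[ℂ] H} {C : ℝ} (hC : ∀ᶠ i in l, ‖T i‖ ≤ C)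
    (hT : Tendsto (fun i => T i * A) l (𝓝 (L * A))) (hA : DenseRange A) (v : H) :
    Tendsto (fun i => T i v) l (𝓝 (L v)) := by
  rw [Metric.tendsto_nhds]
  intro ε hε
  -- `|C| + ‖L‖` bounds the cost of replacing `v` by `A w` in both operators; the `1` keeps `K`
  -- positive.
  set K := |C| + ‖L‖ + 1 with hK
  have hK0 : 0 < K := by positivity
  obtain ⟨w, hw⟩ := hA.exists_dist_lt v (ε := ε / (2 * K)) (by positivity)
  have h1 : Tendsto (fun i => T i (A w)) l (𝓝 (L (A w))) :=
    ((ContinuousLinearMap.apply ℂ H w).continuous.tendsto _).comp hT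
  filter_upwards [hC, Metric.tendsto_nhds.1 h1 (ε / 2) (by positivity)] with i hi h2
  rw [dist_eq_norm] at *
  have h3 : T i v - L v = T i (v - A w) - L (v - A w) + (T i (A w) - L (A w)) := by
    simp only [map_sub]; abel
  have h4 : ‖T i (v - A w)‖ ≤ |C| * ‖v - A w‖ :=
    (T i).le_of_opNorm_le (hi.trans (le_abs_self C)) _
  have h5 := L.le_opNorm (v - A w)
  have h6 : K * ‖v - A w‖ < ε / 2 := by
    calc K * ‖v - A w‖ < K * (ε / (2 * K)) := by gcongr
      _ = ε / 2 := by field_simp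
  rw [h3]
  calc _ ≤ ‖T i (v - A w)‖ + ‖L (v - A w)‖ + ‖T i (A w) - L (A w)‖ :=
        (norm_add_le _ _).trans (by gcongr; exact norm_sub_le _ _)
    _ < ε := by nlinarith [norm_nonneg (v - A w)]

/-- `l ^ s → 1` is not uniform near `l = 0`; the extra factor `l` absorbs the logarithm. Bernoulli
bounds `l ^ s` above by `1 + s (l - 1)`, and convexity of `exp` bounds it below by `1 + s log l`,
with `l log l ≥ l - 1 ≥ -1`. -/
theorem abs_rpow_mul_self_sub_le {s l : ℝ} (hs0 : 0 < s) (hs1 : s ≤ 1) (hl : l ∈ Set.Icc (0 : ℝ) 2) :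
    |l ^ s * l - l| ≤ 2 * s := by
  obtain ⟨h0, h2⟩ := hl
  rcases h0.eq_or_lt with rfl | h0
  · simp [hs0.le]
  · have hup : l ^ s ≤ 1 + s * (l - 1) := by
      have := rpow_one_add_le_one_add_mul_self (s := l - 1) (by linarith) hs0.le hs1
      simpa using this
    have hlo : 1 + s * Real.log l ≤ l ^ s := by
      rw [Real.rpow_def_of_pos h0]
      linarith [Real.add_one_le_exp (Real.log l * s)]
    have hlog := Real.one_sub_inv_le_log_of_pos h0
    have h3 : l * (1 - l⁻¹) = l - 1 := by field_simp
    have h4 : l - 1 ≤ l * Real.log l := by rw [← h3]; gcongr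
    rw [abs_le]
    constructor
    · have : (1 + s * Real.log l) * l ≤ l ^ s * l := by gcongr
      nlinarith
    · have : l ^ s * l ≤ (1 + s * (l - 1)) * l := by gcongr
      nlinarith [mul_nonneg hs0.le h0.le]

variable {A : H →L[ℂ] H}

/-- `A ^ s → 1` strongly as `s → 0+`, for an injective `A` with spectrum in `[0, 2]`. -/
theorem tendsto_functionOfOperator_rpow (hA : IsSelfAdjoint A) (hspec : spectrum ℝ A ⊆ Set.Icc 0 2)
    (hker : ∀ v, A v = 0 → v = 0) (v : H) :
    Tendsto (fun s : ℝ => functionOfOperator (fun l => l ^ s) A v) (𝓝[>] 0) (𝓝 v) := by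
  have hev : ∀ᶠ s : ℝ in 𝓝[>] 0, 0 < s ∧ s ≤ 1 := by
    filter_upwards [Ioc_mem_nhdsGT (zero_lt_one (α := ℝ))] with s hs using hs
  refine tendsto_apply_of_tendsto_mul (C := 2) (L := 1) ?_ ?_ (hA.denseRange_of_injective hker) v
  · filter_upwards [hev] with s hs
    refine norm_cfc_le (by norm_num) fun l hl => ?_
    obtain ⟨h0, h2⟩ := hspec hl
    rw [Real.norm_of_nonneg (Real.rpow_nonneg h0 s)]
    calc l ^ s ≤ 2 ^ s := Real.rpow_le_rpow h0 h2 hs.1.le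
      _ ≤ 2 ^ (1 : ℝ) := Real.rpow_le_rpow_of_exponent_le (by norm_num) hs.2
      _ = 2 := Real.rpow_one 2
  · rw [tendsto_iff_norm_sub_tendsto_zero]
    have hlim : Tendsto (fun s : ℝ => 2 * s) (𝓝[>] 0) (𝓝 0) := by
      have : Tendsto (fun s : ℝ => 2 * s) (𝓝 0) (𝓝 (2 * 0)) := by
        exact tendsto_id.const_mul 2
      rw [mul_zero] at this
      exact this.mono_left nhdsWithin_le_nhds
    refine squeeze_zero' (Eventually.of_forall fun s => norm_nonneg _) ?_ hlim
    filter_upwards [hev] with s hs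
    have hc : ContinuousOn (fun l : ℝ => l ^ s) (spectrum ℝ A) :=
      (Real.continuous_rpow_const hs.1.le).continuousOn
    have h1 : functionOfOperator (fun l => l ^ s) A * A - 1 * A =
        cfc (p := IsSelfAdjoint) (fun l : ℝ => l ^ s * l - l) A := by
      rw [cfc_sub (fun l : ℝ => l ^ s * l) (fun l => l) A (hc.mul continuousOn_id) continuousOn_id,
        cfc_mul (fun l : ℝ => l ^ s) (fun l => l) A hc continuousOn_id, cfc_id' ℝ A hA, one_mul]
      rfl
    rw [h1]
    exact norm_cfc_le (by linarith [hs.1]) fun l hl =>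
      abs_rpow_mul_self_sub_le hs.1 hs.2 (hspec hl)

/-- `exp (-t A) → 0` strongly as `t → ∞`, for an injective `A` with spectrum in `[0, 2]`. -/
theorem tendsto_functionOfOperator_exp (hA : IsSelfAdjoint A) (hspec : spectrum ℝ A ⊆ Set.Icc 0 2)
    (hker : ∀ v, A v = 0 → v = 0) (v : H) :
    Tendsto (fun t : ℝ => functionOfOperator (fun l => Real.exp (-t * l)) A v) atTop (𝓝 0) := by
  refine tendsto_apply_of_tendsto_mul (C := 1) (L := 0) ?_ ?_ (hA.denseRange_of_injective hker) v
  · filter_upwards [eventually_ge_atTop 0] with t ht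
    refine norm_cfc_le zero_le_one fun l hl => ?_
    rw [Real.norm_of_nonneg (Real.exp_nonneg _), Real.exp_le_one_iff]
    nlinarith [mul_nonneg ht (hspec hl).1]
  · rw [tendsto_iff_norm_sub_tendsto_zero]
    refine squeeze_zero' (Eventually.of_forall fun s => norm_nonneg _) ?_ tendsto_inv_atTop_zero
    filter_upwards [eventually_gt_atTop 0] with t ht
    have hc : ContinuousOn (fun l : ℝ => Real.exp (-t * l)) (spectrum ℝ A) := by fun_prop
    have h1 : functionOfOperator (fun l => Real.exp (-t * l)) A * A - 0 * A =
        cfc (p := IsSelfAdjoint) (fun l : ℝ => Real.exp (-t * l) * l) A := by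
      rw [cfc_mul (fun l : ℝ => Real.exp (-t * l)) (fun l => l) A hc continuousOn_id,
        cfc_id' ℝ A hA, zero_mul, sub_zero]
      rfl
    rw [h1]
    refine norm_cfc_le (by positivity) fun l hl => ?_
    have hl0 := (hspec hl).1
    rw [Real.norm_of_nonneg (by positivity)]
    -- This is `exp (-t l) * l ≤ 1 / t`, the uniform decay rate.
    have h2 : t * l ≤ Real.exp (t * l) := by linarith [Real.add_one_le_exp (t * l)]
    rw [neg_mul, Real.exp_neg]
    rw [inv_mul_le_iff₀ (Real.exp_pos _), ← div_eq_mul_inv, le_div_iff₀ ht]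
    linarith

theorem hasSum_functionOfOperator_exp (hA : IsSelfAdjoint A) (t : ℝ) :
    HasSum (fun n : ℕ => (Real.exp (-t) * (t ^ n / n.factorial)) • (1 - A) ^ n)
      (functionOfOperator (fun l => Real.exp (-t * l)) A) :=
  hA.hasSum_cfc_exp t

theorem continuous_functionOfOperator_exp (hA : IsSelfAdjoint A) :
    Continuous fun t : ℝ => functionOfOperator (fun l => Real.exp (-t * l)) A :=
  hA.continuous_cfc_exp

end BoundedOperators

/-! ### An Abelian theorem for the measures `s t^{-1-s} dt`. -/

section Abelian

/-- If `f` is `O(min(1, t))`, then `f(t) t^{-1-s}` is integrable on `(0, ∞)`. -/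
theorem integrableOn_mul_rpow_of_abs_le_min {f : ℝ → ℝ} {C s : ℝ}
    (hf : AEStronglyMeasurable f (volume.restrict (Set.Ioi 0)))
    (hC : ∀ t, 0 < t → |f t| ≤ C * min 1 t) (hs0 : 0 < s) (hs1 : s < 1) :
    IntegrableOn (fun t : ℝ => f t * t ^ (-1 - s)) (Set.Ioi 0) := by
  have hmeas : AEStronglyMeasurable (fun t : ℝ => f t * t ^ (-1 - s))
      (volume.restrict (Set.Ioi 0)) :=
    hf.mul (Measurable.aestronglyMeasurable (by fun_prop))
  -- On `(0, 1]` the majorant is `C t^{-s}`, integrable as `s < 1`; on `(1, ∞)` it is `C t^{-1-s}`,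
  -- integrable as `s > 0`.
  rw [← Set.Ioc_union_Ioi_eq_Ioi (zero_le_one (α := ℝ))]
  refine IntegrableOn.union ?_ ?_
  · have h1 : IntegrableOn (fun t : ℝ => C * t ^ (-s)) (Set.Ioc 0 1) := by
      refine Integrable.const_mul ?_ C
      rw [← IntegrableOn, integrableOn_Ioc_iff_integrableOn_Ioo]
      exact (intervalIntegral.integrableOn_Ioo_rpow_iff zero_lt_one).2 (by linarith)
    refine Integrable.mono' h1 (hmeas.mono_measure
      (Measure.restrict_mono Set.Ioc_subset_Ioi_self le_rfl)) ?_
    filter_upwards [ae_restrict_mem measurableSet_Ioc] with t ht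
    rw [norm_mul, Real.norm_eq_abs, Real.norm_of_nonneg (Real.rpow_nonneg ht.1.le _)]
    have h2 : t ^ (-s) = t * t ^ (-1 - s) := by
      nth_rewrite 2 [← Real.rpow_one t]
      rw [← Real.rpow_add ht.1]; ring_nf
    rw [h2, ← mul_assoc]
    have h3 := hC t ht.1
    rw [min_eq_right ht.2] at h3
    exact mul_le_mul_of_nonneg_right h3 (Real.rpow_nonneg ht.1.le _)
  · have h1 : IntegrableOn (fun t : ℝ => C * t ^ (-1 - s)) (Set.Ioi 1) :=
      Integrable.const_mul (integrableOn_Ioi_rpow_of_lt (by linarith) zero_lt_one) C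
    refine Integrable.mono' h1 (hmeas.mono_measure
      (Measure.restrict_mono (Set.Ioi_subset_Ioi zero_le_one) le_rfl)) ?_
    filter_upwards [ae_restrict_mem measurableSet_Ioi] with t ht
    have ht' : (1 : ℝ) < t := ht
    rw [norm_mul, Real.norm_eq_abs, Real.norm_of_nonneg (Real.rpow_nonneg (by linarith) _)]
    have h3 := hC t (by linarith)
    rw [min_eq_left ht'.le, mul_one] at h3
    exact mul_le_mul_of_nonneg_right h3 (Real.rpow_nonneg (by linarith) _)

/-- If `f` is `O(min(1, t))` and tends to `L` at infinity, then
`s ∫₀^∞ f(t) t^{-1-s} dt → L` as `s → 0+`. -/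
theorem tendsto_mul_integral_rpow_of_tendsto_atTop {f : ℝ → ℝ} {C L : ℝ}
    (hf : AEStronglyMeasurable f (volume.restrict (Set.Ioi 0)))
    (hC : ∀ t, 0 < t → |f t| ≤ C * min 1 t) (hL : Tendsto f atTop (𝓝 L)) :
    Tendsto (fun s : ℝ => s * ∫ t in Set.Ioi (0 : ℝ), f t * t ^ (-1 - s)) (𝓝[>] 0) (𝓝 L) := by
  have hC0 : 0 ≤ C := by simpa using (abs_nonneg _).trans (hC 1 one_pos)
  have hIoo : ∀ᶠ s : ℝ in 𝓝[>] 0, s ∈ Set.Ioo (0 : ℝ) 1 := Ioo_mem_nhdsGT zero_lt_one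
  rw [Metric.tendsto_nhds]
  intro ε hε
  obtain ⟨T, hT1, hT⟩ : ∃ T : ℝ, 1 ≤ T ∧ ∀ t, T ≤ t → |f t - L| ≤ ε / 2 := by
    obtain ⟨T, hT⟩ := eventually_atTop.1 (Metric.tendsto_nhds.1 hL (ε / 2) (by positivity))
    exact ⟨max T 1, le_max_right _ _, fun t ht => (hT t ((le_max_left _ _).trans ht)).le⟩
  have hT0 : 0 < T := by linarith
  -- The three terms bound the contribution of `(0, T]`, the defect of `s ∫_T^∞ t^{-1-s} dt =
  -- T^{-s}` from `1`, and the tail where `|f - L| ≤ ε / 2`. As `s → 0` only the last one survives.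
  have hlim : Tendsto (fun s : ℝ => s * (C * (T ^ (1 - s) / (1 - s))) + |L| * |T ^ (-s) - 1|
      + ε / 2 * T ^ (-s)) (𝓝[>] 0) (𝓝 (ε / 2)) := by
    have hcont : ContinuousAt (fun s : ℝ => s * (C * (T ^ (1 - s) / (1 - s)))
        + |L| * |T ^ (-s) - 1| + ε / 2 * T ^ (-s)) 0 := by
      have h1 : ContinuousAt (fun s : ℝ => T ^ (1 - s)) 0 :=
        ContinuousAt.rpow (by fun_prop) (by fun_prop) (Or.inl hT0.ne')
      have h2 : ContinuousAt (fun s : ℝ => T ^ (-s)) 0 :=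
        ContinuousAt.rpow (by fun_prop) (by fun_prop) (Or.inl hT0.ne')
      have h3 : ContinuousAt (fun s : ℝ => T ^ (1 - s) / (1 - s)) 0 :=
        h1.div (by fun_prop) (by norm_num)
      fun_prop
    have h := hcont.tendsto
    simp only [neg_zero, Real.rpow_zero, zero_mul, sub_self, abs_zero, mul_zero, mul_one,
      zero_add] at h
    exact h.mono_left nhdsWithin_le_nhds
  filter_upwards [hIoo, hlim.eventually_lt_const (half_lt_self hε)] with s hs hlt
  refine lt_of_le_of_lt ?_ hlt
  obtain ⟨hs0, hs1⟩ := hs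
  have hint := integrableOn_mul_rpow_of_abs_le_min hf hC hs0 hs1
  have hpow : IntegrableOn (fun t : ℝ => t ^ (-1 - s)) (Set.Ioi T) :=
    integrableOn_Ioi_rpow_of_lt (by linarith) hT0
  have hpowval : ∫ t in Set.Ioi T, t ^ (-1 - s) = T ^ (-s) / s := by
    rw [integral_Ioi_rpow_of_lt (by linarith) hT0]
    rw [show -1 - s + 1 = -s by ring, neg_div_neg_eq]
  have hI1 : IntegrableOn (fun t : ℝ => f t * t ^ (-1 - s)) (Set.Ioc 0 T) :=
    hint.mono_set Set.Ioc_subset_Ioi_self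
  have hI2 : IntegrableOn (fun t : ℝ => f t * t ^ (-1 - s)) (Set.Ioi T) :=
    hint.mono_set (Set.Ioi_subset_Ioi hT0.le)
  have hsplit : ∫ t in Set.Ioi (0 : ℝ), f t * t ^ (-1 - s) =
      (∫ t in Set.Ioc 0 T, f t * t ^ (-1 - s)) + (∫ t in Set.Ioi T, (f t - L) * t ^ (-1 - s))
        + L * (T ^ (-s) / s) := by
    rw [← Set.Ioc_union_Ioi_eq_Ioi hT0.le, setIntegral_union
      (Set.Ioc_disjoint_Ioi le_rfl) measurableSet_Ioi hI1 hI2, add_assoc, ← hpowval,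
      ← integral_const_mul, ← integral_add _ (hpow.const_mul L)]
    · simp only [sub_mul, sub_add_cancel]
    · simp only [sub_mul]
      exact hI2.sub (hpow.const_mul L)
  have hA : |∫ t in Set.Ioc 0 T, f t * t ^ (-1 - s)| ≤ C * (T ^ (1 - s) / (1 - s)) := by
    have hi : IntegrableOn (fun t : ℝ => t ^ (-s)) (Set.Ioc 0 T) := by
      rw [integrableOn_Ioc_iff_integrableOn_Ioo]
      exact (intervalIntegral.integrableOn_Ioo_rpow_iff hT0).2 (by linarith)
    have hval : ∫ t in Set.Ioc 0 T, t ^ (-s) = T ^ (1 - s) / (1 - s) := by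
      rw [← intervalIntegral.integral_of_le hT0.le, integral_rpow (Or.inl (by linarith)),
        Real.zero_rpow (by linarith)]
      ring_nf
    rw [← hval, ← integral_const_mul, ← Real.norm_eq_abs]
    refine norm_integral_le_of_norm_le (hi.const_mul C) ?_
    filter_upwards [ae_restrict_mem measurableSet_Ioc] with t ht
    rw [norm_mul, Real.norm_eq_abs, Real.norm_of_nonneg (Real.rpow_nonneg ht.1.le _)]
    have h2 : t ^ (-s) = t * t ^ (-1 - s) := by
      nth_rewrite 2 [← Real.rpow_one t]
      rw [← Real.rpow_add ht.1]; ring_nf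
    rw [h2, ← mul_assoc]
    exact mul_le_mul_of_nonneg_right ((hC t ht.1).trans (by gcongr; exact min_le_right _ _))
      (Real.rpow_nonneg ht.1.le _)
  have hB : |∫ t in Set.Ioi T, (f t - L) * t ^ (-1 - s)| ≤ ε / 2 * (T ^ (-s) / s) := by
    rw [← hpowval, ← integral_const_mul, ← Real.norm_eq_abs]
    refine norm_integral_le_of_norm_le (hpow.const_mul _) ?_
    filter_upwards [ae_restrict_mem measurableSet_Ioi] with t ht
    have ht' : T < t := ht
    rw [norm_mul, Real.norm_eq_abs, Real.norm_of_nonneg (Real.rpow_nonneg (by linarith) _)]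
    exact mul_le_mul_of_nonneg_right (hT t ht'.le) (Real.rpow_nonneg (by linarith) _)
  rw [Real.dist_eq, hsplit]
  have heq : s * ((∫ t in Set.Ioc 0 T, f t * t ^ (-1 - s)) +
      (∫ t in Set.Ioi T, (f t - L) * t ^ (-1 - s)) + L * (T ^ (-s) / s)) - L =
      s * (∫ t in Set.Ioc 0 T, f t * t ^ (-1 - s)) + L * (T ^ (-s) - 1)
       + s * (∫ t in Set.Ioi T, (f t - L) * t ^ (-1 - s)) := by
    field_simp
    ring
  rw [heq]
  refine (abs_add_le _ _).trans (add_le_add ((abs_add_le _ _).trans (add_le_add ?_ ?_)) ?_)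
  · rw [abs_mul, abs_of_pos hs0]; gcongr
  · rw [abs_mul]
  · rw [abs_mul, abs_of_pos hs0]
    calc s * _ ≤ s * (ε / 2 * (T ^ (-s) / s)) := by gcongr
      _ = _ := by field_simp

end Abelian

/-! ### The Markov operator: contractivity and absence of harmonic functions. -/

namespace WeightedLattice

variable {d : ℕ} (G : WeightedLattice d)

/-- The Markov operator `P = 1 + Δ` of the random walk. -/
noncomputable def markov : G.L2 →L[ℂ] G.L2 := 1 - G.negLaplacian

theorem markov_apply (f : G.L2) (x : Fin d → ℤ) :
    G.markov f x = ((G.μ x : ℝ) : ℂ)⁻¹ *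
      ∑ y ∈ Finset.Icc (x - 1) (x + 1), ((G.w x y : ℝ) : ℂ) * f y := by
  have h1 : G.markov f x = f x - G.negLaplacian f x :=
    G.forall_of_ae (Lp.coeFn_sub f (G.negLaplacian f)) x
  have hμ : (G.μ x : ℂ) ≠ 0 := by exact_mod_cast (G.μ_pos x).ne'
  rw [h1, negLaplacian_apply, lap_eq_sum, sub_neg_eq_add]
  simp only [mul_sub, Finset.sum_sub_distrib, ← Finset.sum_mul]
  have h2 : ∑ y ∈ Finset.Icc (x - 1) (x + 1), ((G.w x y : ℝ) : ℂ) = G.μ x := by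
    rw [G.μ_eq_sum]; push_cast; rfl
  rw [h2, inv_mul_cancel_left₀ hμ]
  ring

/-- Cauchy–Schwarz for the weights `w x ·`, whose total mass is `μ x`. -/
theorem markov_sq_le (f : G.L2) (x : Fin d → ℤ) :
    G.μ x * ‖G.markov f x‖ ^ 2 ≤
      ∑ y ∈ Finset.Icc (x - 1) (x + 1), G.w x y * ‖f y‖ ^ 2 := by
  have hμ := G.μ_pos x
  set N := Finset.Icc (x - 1) (x + 1)
  set S := ∑ y ∈ N, ((G.w x y : ℝ) : ℂ) * f y with hS
  have h1 : ‖S‖ ^ 2 ≤ G.μ x * ∑ y ∈ N, G.w x y * ‖f y‖ ^ 2 := by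
    have h2 : ‖S‖ ≤ ∑ y ∈ N, G.w x y * ‖f y‖ := by
      refine (norm_sum_le _ _).trans (Finset.sum_le_sum fun y _ => ?_)
      rw [norm_mul, Complex.norm_real, Real.norm_of_nonneg (G.w_nonneg x y)]
    have h3 : (∑ y ∈ N, G.w x y * ‖f y‖) ^ 2 ≤
        (∑ y ∈ N, G.w x y) * ∑ y ∈ N, G.w x y * ‖f y‖ ^ 2 :=
      Finset.sum_sq_le_sum_mul_sum_of_sq_le_mul N (fun y _ => G.w_nonneg x y)
        (fun y _ => mul_nonneg (G.w_nonneg x y) (sq_nonneg _)) (fun y _ => le_of_eq (by ring))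
    rw [G.μ_eq_sum]
    exact (pow_le_pow_left₀ (norm_nonneg _) h2 2).trans h3
  rw [markov_apply, norm_mul, norm_inv, Complex.norm_real, Real.norm_of_nonneg hμ.le]
  calc G.μ x * ((G.μ x)⁻¹ * ‖S‖) ^ 2 = (G.μ x)⁻¹ * ‖S‖ ^ 2 := by field_simp
    _ ≤ (G.μ x)⁻¹ * (G.μ x * ∑ y ∈ N, G.w x y * ‖f y‖ ^ 2) := by gcongr
    _ = ∑ y ∈ N, G.w x y * ‖f y‖ ^ 2 := by field_simp

theorem markov_sq_le_tsum (f : G.L2) (x : Fin d → ℤ) :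
    ENNReal.ofReal (G.μ x) * ‖G.markov f x‖ₑ ^ 2 ≤
      ∑' y, ENNReal.ofReal (G.w x y) * ‖f y‖ₑ ^ 2 := by
  have h := ENNReal.ofReal_le_ofReal (G.markov_sq_le f x)
  rw [ENNReal.ofReal_mul (G.μ_pos x).le, ENNReal.ofReal_pow (norm_nonneg _), ofReal_norm,
    ENNReal.ofReal_sum_of_nonneg fun y _ => mul_nonneg (G.w_nonneg x y) (by positivity)] at h
  refine h.trans (le_trans (le_of_eq ?_) (ENNReal.sum_le_tsum (Finset.Icc (x - 1) (x + 1))))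
  refine Finset.sum_congr rfl fun y _ => ?_
  rw [ENNReal.ofReal_mul (G.w_nonneg x y), ENNReal.ofReal_pow (norm_nonneg _), ofReal_norm]

/-- Summing the pointwise bound over `x` and exchanging sums leaves `∑_x w x y`, which is `μ y` by
symmetry. -/
theorem eLpNorm_markov_le (f : G.L2) :
    eLpNorm (G.markov f) 2 G.vol ≤ eLpNorm f 2 G.vol := by
  refine (ENNReal.pow_le_pow_left_iff two_ne_zero).1 ?_
  rw [eLpNorm_sq, eLpNorm_sq]
  refine (ENNReal.tsum_le_tsum fun x => G.markov_sq_le_tsum f x).trans (le_of_eq ?_)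
  rw [ENNReal.tsum_comm]
  refine tsum_congr fun y => ?_
  rw [ENNReal.tsum_mul_right, ofReal_μ]
  congr 1
  exact tsum_congr fun x => by rw [G.symm]

theorem norm_markov_le : ‖G.markov‖ ≤ 1 := by
  refine ContinuousLinearMap.opNorm_le_bound _ zero_le_one fun f => ?_
  rw [one_mul, Lp.norm_def, Lp.norm_def]
  exact ENNReal.toReal_mono (Lp.eLpNorm_ne_top f) (G.eLpNorm_markov_le f)

theorem spectrum_negLaplacian_subset : spectrum ℝ G.negLaplacian ⊆ Set.Icc 0 2 :=
  spectrum_subset_Icc_of_norm_one_sub_le G.norm_markov_le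

/-- Elements of `ℓ²(ℤ^d, μ)` vanish at infinity, as `μ` is bounded below. -/
theorem finite_le_norm (f : G.L2) {ε : ℝ} (hε : 0 < ε) : {x | ε ≤ ‖f x‖}.Finite := by
  obtain ⟨c, hc, hμ⟩ := G.inf_pos
  have h1 : ∑' x, ENNReal.ofReal (G.μ x) * ‖f x‖ₑ ^ 2 ≠ ∞ := by
    rw [← eLpNorm_sq]
    exact ENNReal.pow_ne_top (Lp.eLpNorm_ne_top f)
  have h2 : ENNReal.ofReal (c * ε ^ 2) ≠ 0 := by
    rw [Ne, ENNReal.ofReal_eq_zero, not_le]; positivity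
  refine (ENNReal.finite_const_le_of_tsum_ne_top h1 h2).subset fun x hx => ?_
  have hx' : ε ≤ ‖f x‖ := hx
  show _ ≤ ENNReal.ofReal (G.μ x) * ‖f x‖ₑ ^ 2
  rw [← ofReal_norm, ← ENNReal.ofReal_pow (norm_nonneg _), ← ENNReal.ofReal_mul (G.μ_pos x).le]
  refine ENNReal.ofReal_le_ofReal ?_
  exact mul_le_mul (hμ x) (pow_le_pow_left₀ hε.le hx' 2) (by positivity) (G.μ_pos x).le

/-- The maximum principle: if `P f = f` and `|f|` attains its maximum `M` at `x`, then it also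
does so at every neighbour of `x`. -/
theorem norm_eq_of_latticeAdj {f : G.L2} (hf : G.markov f = f) {x y : Fin d → ℤ} {M : ℝ}
    (hM : ∀ z, ‖f z‖ ≤ M) (hx : ‖f x‖ = M) (hxy : LatticeAdj x y) : ‖f y‖ = M := by
  refine le_antisymm (hM y) (not_lt.1 fun hlt => ?_)
  have hμ := G.μ_pos x
  have hw := G.pos_of_adj x y hxy
  have hy : y ∈ Finset.Icc (x - 1) (x + 1) := by
    by_contra h
    exact hw.ne' (G.w_eq_zero_of_notMem x y h)
  have h1 := G.markov_apply f x
  rw [hf] at h1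
  have h2 : G.μ x * M ≤ ∑ z ∈ Finset.Icc (x - 1) (x + 1), G.w x z * ‖f z‖ := by
    have h3 : (G.μ x : ℂ) * f x =
        ∑ z ∈ Finset.Icc (x - 1) (x + 1), ((G.w x z : ℝ) : ℂ) * f z := by
      rw [h1, mul_inv_cancel_left₀ (by exact_mod_cast hμ.ne')]
    have h4 : G.μ x * M = ‖(G.μ x : ℂ) * f x‖ := by
      rw [norm_mul, Complex.norm_real, Real.norm_of_nonneg hμ.le, hx]
    rw [h4, h3]
    refine (norm_sum_le _ _).trans (Finset.sum_le_sum fun z _ => ?_)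
    rw [norm_mul, Complex.norm_real, Real.norm_of_nonneg (G.w_nonneg x z)]
  have h5 : ∑ z ∈ Finset.Icc (x - 1) (x + 1), G.w x z * ‖f z‖ <
      ∑ z ∈ Finset.Icc (x - 1) (x + 1), G.w x z * M :=
    Finset.sum_lt_sum (fun z _ => mul_le_mul_of_nonneg_left (hM z) (G.w_nonneg x z))
      ⟨y, hy, mul_lt_mul_of_pos_left hlt hw⟩
  rw [← Finset.sum_mul, ← G.μ_eq_sum] at h5
  linarith

theorem latticeAdj_add_single (x : Fin d → ℤ) (i : Fin d) : LatticeAdj x (x + Pi.single i 1) := by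
  rw [LatticeAdj, Finset.sum_eq_single i]
  · simp
  · intro j _ hj
    simp [hj]
  · simp

/-- The maximum of `|f|` exists because a superlevel set is finite, and it would recur at all points
`x + n e`, making that set infinite. Positivity of `d` supplies the direction `e`; for `d = 0` the
Laplacian is zero. -/
theorem negLaplacian_injective (hd : 0 < d) (f : G.L2) (hf : G.negLaplacian f = 0) : f = 0 := by
  have hP : G.markov f = f := by
    rw [markov, sub_apply, hf, sub_zero]; rfl
  have key : ∀ x, f x = 0 := by
    by_contra! h
    obtain ⟨x₀, hx₀⟩ := h
    have hfin := G.finite_le_norm f (norm_pos_iff.2 hx₀)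
    obtain ⟨x, hx, hmax⟩ := Set.exists_max_image _ (fun z => ‖f z‖) hfin ⟨x₀, le_refl ‖f x₀‖⟩
    have hM : ∀ z, ‖f z‖ ≤ ‖f x‖ := fun z => by
      by_cases hz : ‖f x₀‖ ≤ ‖f z‖
      · exact hmax z hz
      · exact (not_le.1 hz).le.trans hx
    let e : Fin d → ℤ := Pi.single ⟨0, hd⟩ 1
    have hn : ∀ n : ℕ, ‖f (x + n • e)‖ = ‖f x‖ := by
      intro n
      induction n with
      | zero => simp
      | succ n ih =>
        rw [succ_nsmul, ← add_assoc]
        exact G.norm_eq_of_latticeAdj hP hM ih (latticeAdj_add_single _ _)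
    refine Set.infinite_of_injective_forall_mem (f := fun n : ℕ => x + n • e) ?_
      (fun n => ?_) hfin
    · intro m n hmn
      have := congrFun (add_left_cancel hmn) ⟨0, hd⟩
      simpa [e] using this
    · change ‖f x₀‖ ≤ ‖f (x + n • e)‖
      rw [hn]; exact hx
  refine G.ext_of_inner fun x => ?_
  rw [inner_pointMass, key x]
  simp

/-! ### Transition probabilities -/

/-- The real number `⟨1_x, P^n 1_y⟩ = μ(x) P^n(x, y)`. -/
noncomputable def stepKernel (n : ℕ) (x y : Fin d → ℤ) : ℝ :=
  (inner ℂ (G.pointMass x) ((G.markov ^ n) (G.pointMass y))).re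

theorem stepKernel_zero (x y : Fin d → ℤ) : G.stepKernel 0 x y = if x = y then G.μ x else 0 := by
  rw [stepKernel, pow_zero, one_apply_eq_self, inner_pointMass, pointMass_apply]
  split_ifs <;> simp

/-- Since `stepKernel n z y` carries the factor `μ z`, one step from `x` contributes `w x z / μ z`
rather than `w x z / μ x`. -/
theorem stepKernel_succ (n : ℕ) (x y : Fin d → ℤ) :
    G.stepKernel (n + 1) x y =
      ∑ z ∈ Finset.Icc (x - 1) (x + 1), G.w x z / G.μ z * G.stepKernel n z y := by
  have hμ : ∀ z, (G.μ z : ℂ) ≠ 0 := fun z => by exact_mod_cast (G.μ_pos z).ne'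
  rw [stepKernel, pow_succ', mul_apply_eq_comp, inner_pointMass, markov_apply,
    mul_inv_cancel_left₀ (hμ x), Complex.re_sum]
  refine Finset.sum_congr rfl fun z _ => ?_
  rw [stepKernel, inner_pointMass, Complex.re_ofReal_mul, Complex.re_ofReal_mul]
  have := (G.μ_pos z).ne'
  field_simp

theorem stepKernel_nonneg (n : ℕ) (x y : Fin d → ℤ) : 0 ≤ G.stepKernel n x y := by
  induction n generalizing x with
  | zero =>
    rw [stepKernel_zero]
    split_ifs
    exacts [(G.μ_pos x).le, le_rfl]
  | succ n ih =>
    rw [stepKernel_succ]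
    exact Finset.sum_nonneg fun z _ =>
      mul_nonneg (div_nonneg (G.w_nonneg x z) (G.μ_pos z).le) (ih z)

theorem hasSum_stepKernel (n : ℕ) (x : Fin d → ℤ) :
    HasSum (fun y => G.stepKernel n x y) (G.μ x) := by
  induction n generalizing x with
  | zero =>
    simp_rw [stepKernel_zero, eq_comm (a := x)]
    exact hasSum_ite_eq x (G.μ x)
  | succ n ih =>
    simp_rw [stepKernel_succ]
    have h : G.μ x = ∑ z ∈ Finset.Icc (x - 1) (x + 1), G.w x z / G.μ z * G.μ z := by
      rw [G.μ_eq_sum x]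
      exact Finset.sum_congr rfl fun z _ => (div_mul_cancel₀ _ (G.μ_pos z).ne').symm
    rw [h]
    exact hasSum_sum fun z _ => (ih z).mul_left _

/-! ### The heat matrix -/

/-- The real number `⟨1_x, e^{tΔ} 1_y⟩ = μ(x) μ(y) p(t, x, y)`. -/
noncomputable def heatMatrix (t : ℝ) (x y : Fin d → ℤ) : ℝ :=
  (inner ℂ (G.pointMass x) (G.heatSemigroup t (G.pointMass y))).re

theorem heatKernel_eq (t : ℝ) (x y : Fin d → ℤ) :
    G.heatKernel t x y = 1 / (G.μ x * G.μ y) * G.heatMatrix t x y := rfl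

/-- The matrix coefficient `T ↦ Re ⟨1_x, T 1_y⟩`, as a continuous linear functional. -/
noncomputable def coefficient (x y : Fin d → ℤ) : (G.L2 →L[ℂ] G.L2) →L[ℝ] ℝ :=
  Complex.reCLM ∘L (((innerSL ℂ (G.pointMass x)) ∘L
    (ContinuousLinearMap.apply ℂ G.L2 (G.pointMass y))).restrictScalars ℝ)

theorem hasSum_heatMatrix (t : ℝ) (x y : Fin d → ℤ) :
    HasSum (fun n : ℕ => Real.exp (-t) * (t ^ n / n.factorial) * G.stepKernel n x y)
      (G.heatMatrix t x y) := by
  refine ((hasSum_functionOfOperator_exp G.isSelfAdjoint_negLaplacian t).mapL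
    (G.coefficient x y)).congr_fun fun n => ?_
  exact ((G.coefficient x y).map_smul (Real.exp (-t) * (t ^ n / n.factorial)) (G.markov ^ n)).symm

theorem continuous_heatMatrix (x y : Fin d → ℤ) : Continuous fun t => G.heatMatrix t x y :=
  (G.coefficient x y).continuous.comp
    (continuous_functionOfOperator_exp G.isSelfAdjoint_negLaplacian)

theorem tendsto_heatMatrix_atTop (hd : 0 < d) (x y : Fin d → ℤ) :
    Tendsto (fun t => G.heatMatrix t x y) atTop (𝓝 0) := by
  have h := tendsto_functionOfOperator_exp G.isSelfAdjoint_negLaplacian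
    G.spectrum_negLaplacian_subset (G.negLaplacian_injective hd) (G.pointMass y)
  have h2 := (Complex.continuous_re.comp (innerSL ℂ (G.pointMass x)).continuous).tendsto 0
  have h3 : (Complex.re ∘ innerSL ℂ (G.pointMass x)) 0 = 0 := by simp
  rw [h3] at h2
  exact h2.comp h

theorem heatMatrix_nonneg {t : ℝ} (ht : 0 ≤ t) (x y : Fin d → ℤ) : 0 ≤ G.heatMatrix t x y :=
  (G.hasSum_heatMatrix t x y).nonneg fun n => mul_nonneg (by positivity) (G.stepKernel_nonneg n x y)

/-- Stochastic completeness. -/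
theorem hasSum_heatMatrix_right {t : ℝ} (ht : 0 ≤ t) (x : Fin d → ℤ) :
    HasSum (fun y => G.heatMatrix t x y) (G.μ x) := by
  have hexp : HasSum (fun n : ℕ => Real.exp (-t) * (t ^ n / n.factorial) * G.μ x) (G.μ x) := by
    have h := (NormedSpace.expSeries_div_hasSum_exp t).mul_left (Real.exp (-t)) |>.mul_right (G.μ x)
    rw [← Real.exp_eq_exp_ℝ, ← Real.exp_add, neg_add_cancel, Real.exp_zero, one_mul] at h
    exact h
  have hrow : ∀ n : ℕ, HasSum (fun y => Real.exp (-t) * (t ^ n / n.factorial) * G.stepKernel n x y)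
      (Real.exp (-t) * (t ^ n / n.factorial) * G.μ x) := fun n =>
    (G.hasSum_stepKernel n x).mul_left _
  set F : ℕ × (Fin d → ℤ) → ℝ := fun q =>
    Real.exp (-t) * (t ^ q.1 / q.1.factorial) * G.stepKernel q.1 x q.2
  -- Tonelli for a nonnegative double series: summing over `y` first gives the Poisson series of `μ
  -- x`, summing over `n` first gives the entries of the heat matrix.
  have hsum : Summable F := by
    refine (summable_prod_of_nonneg fun q => mul_nonneg (by positivity)
      (G.stepKernel_nonneg _ _ _)).2 ⟨fun n => (hrow n).summable, ?_⟩
    simp only [fun n => (hrow n).tsum_eq]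
    exact hexp.summable
  have h1 : HasSum F (G.μ x) := by
    have := hsum.hasSum
    rwa [(this.prod_fiberwise hrow).unique hexp] at this
  exact ((Equiv.prodComm _ _).hasSum_iff.2 h1).prod_fiberwise fun y => G.hasSum_heatMatrix t x y

/-- The bound by `t` keeps only the `n = 0` term `exp (-t) μ x` (no jump before time `t`) and uses
`1 - t ≤ exp (-t)`; the other bound is positivity of the diagonal entry. This linear vanishing at `t
= 0` makes the singular integrals converge. -/
theorem sub_heatMatrix_self_le {t : ℝ} (ht : 0 ≤ t) (x : Fin d → ℤ) :
    G.μ x - G.heatMatrix t x x ≤ G.μ x * min 1 t := by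
  have hμ := G.μ_pos x
  rw [mul_min_of_nonneg _ _ hμ.le, mul_one]
  refine le_min (sub_le_self _ (G.heatMatrix_nonneg ht x x)) ?_
  have h := le_hasSum (G.hasSum_heatMatrix t x x) 0 fun n _ =>
    mul_nonneg (by positivity) (G.stepKernel_nonneg n x x)
  rw [stepKernel_zero, if_pos rfl, pow_zero, Nat.factorial_zero, Nat.cast_one, div_one, mul_one]
    at h
  have h2 : 1 - t ≤ Real.exp (-t) := by linarith [Real.add_one_le_exp (-t)]
  nlinarith

theorem hasSum_heatMatrix_ne {t : ℝ} (ht : 0 ≤ t) (x : Fin d → ℤ) :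
    HasSum (fun y : {y // y ≠ x} => G.heatMatrix t x y) (G.μ x - G.heatMatrix t x x) := by
  have h := G.hasSum_heatMatrix_right ht x
  have h1 : HasSum (fun y : ({x} : Finset (Fin d → ℤ)) => G.heatMatrix t x y)
      (G.heatMatrix t x x) := by
    simpa [Function.comp_def] using
      Finset.hasSum ({x} : Finset (Fin d → ℤ)) fun y => G.heatMatrix t x y
  have h2 := (Finset.hasSum_compl_iff (f := fun y => G.heatMatrix t x y) {x}
    (a := G.μ x - G.heatMatrix t x x)).2 (by simpa using h)
  refine (Equiv.hasSum_iff (Equiv.subtypeEquivRight fun y => by simp)).1 h2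

/-- A single off-diagonal entry is at most the whole off-diagonal mass, so it inherits the `min 1 t`
bound. -/
theorem heatMatrix_le {t : ℝ} (ht : 0 ≤ t) {x y : Fin d → ℤ} (hy : y ≠ x) :
    G.heatMatrix t x y ≤ G.μ x - G.heatMatrix t x x :=
  le_hasSum (G.hasSum_heatMatrix_ne ht x) ⟨y, hy⟩ fun z _ => G.heatMatrix_nonneg ht x z

theorem abs_heatMatrix_le {t : ℝ} (ht : 0 ≤ t) {x y : Fin d → ℤ} (hy : y ≠ x) :
    |G.heatMatrix t x y| ≤ G.μ x * min 1 t := by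
  rw [abs_of_nonneg (G.heatMatrix_nonneg ht x y)]
  exact (G.heatMatrix_le ht hy).trans (G.sub_heatMatrix_self_le ht x)

theorem abs_sub_heatMatrix_self_le {t : ℝ} (ht : 0 ≤ t) (x : Fin d → ℤ) :
    |G.μ x - G.heatMatrix t x x| ≤ G.μ x * min 1 t := by
  rw [abs_of_nonneg]
  · exact G.sub_heatMatrix_self_le ht x
  · exact sub_nonneg.2 (le_hasSum (G.hasSum_heatMatrix_right ht x) x fun y _ =>
      G.heatMatrix_nonneg ht x y)

/-! ### The fractional weights and their limits as `s → 0+`. -/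

theorem integrableOn_heatMatrix {s : ℝ} (hs : s ∈ Set.Ioo (0 : ℝ) 1) {x y : Fin d → ℤ}
    (hy : y ≠ x) : IntegrableOn (fun t : ℝ => G.heatMatrix t x y * t ^ (-1 - s)) (Set.Ioi 0) :=
  integrableOn_mul_rpow_of_abs_le_min (G.continuous_heatMatrix x y).aestronglyMeasurable
    (fun _ ht => G.abs_heatMatrix_le ht.le hy) hs.1 hs.2

theorem integrableOn_heatKernel {s : ℝ} (hs : s ∈ Set.Ioo (0 : ℝ) 1) {x y : Fin d → ℤ}
    (hy : y ≠ x) : IntegrableOn (fun t : ℝ => G.heatKernel t x y * t ^ (-1 - s)) (Set.Ioi 0) := by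
  simp_rw [heatKernel_eq, mul_assoc]
  exact (G.integrableOn_heatMatrix hs hy).const_mul _

theorem fracWeight_eq (s : ℝ) (x y : Fin d → ℤ) :
    G.fracWeight s x y = (Real.Gamma (1 - s))⁻¹ *
      (s * ∫ t in Set.Ioi (0 : ℝ), G.heatMatrix t x y * t ^ (-1 - s)) := by
  simp_rw [fracWeight, heatKernel_eq, mul_assoc (1 / (G.μ x * G.μ y)), integral_const_mul]
  have hx := (G.μ_pos x).ne'
  have hy := (G.μ_pos y).ne'
  field_simp

/-- The off-diagonal weights `W_s(x, ·)` are summable, with an explicit sum. -/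
theorem hasSum_fracWeight {s : ℝ} (hs : s ∈ Set.Ioo (0 : ℝ) 1) (x : Fin d → ℤ) :
    HasSum (fun y : {y // y ≠ x} => G.fracWeight s x y) ((Real.Gamma (1 - s))⁻¹ *
      (s * ∫ t in Set.Ioi (0 : ℝ), (G.μ x - G.heatMatrix t x x) * t ^ (-1 - s))) := by
  simp_rw [fracWeight_eq]
  refine HasSum.mul_left _ (HasSum.mul_left _ ?_)
  have hnn : ∀ y : {y // y ≠ x}, ∀ t ∈ Set.Ioi (0 : ℝ),
      0 ≤ G.heatMatrix t x y * t ^ (-1 - s) := fun y t ht =>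
    mul_nonneg (G.heatMatrix_nonneg (le_of_lt ht) x y) (Real.rpow_nonneg (le_of_lt ht) _)
  have htot : ∀ t ∈ Set.Ioi (0 : ℝ), HasSum
      (fun y : {y // y ≠ x} => G.heatMatrix t x y * t ^ (-1 - s))
      ((G.μ x - G.heatMatrix t x x) * t ^ (-1 - s)) := fun t ht =>
    (G.hasSum_heatMatrix_ne (le_of_lt ht) x).mul_right _
  have hint : ∀ y : {y // y ≠ x}, IntegrableOn
      (fun t : ℝ => G.heatMatrix t x y * t ^ (-1 - s)) (Set.Ioi 0) := fun y =>
    G.integrableOn_heatMatrix hs y.2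
  have hint0 : IntegrableOn (fun t : ℝ => (G.μ x - G.heatMatrix t x x) * t ^ (-1 - s))
      (Set.Ioi 0) :=
    integrableOn_mul_rpow_of_abs_le_min
      (continuous_const.sub (G.continuous_heatMatrix x x)).aestronglyMeasurable
      (fun _ ht => G.abs_sub_heatMatrix_self_le ht.le x) hs.1 hs.2
  rw [← setIntegral_congr_fun measurableSet_Ioi fun t ht => (htot t ht).tsum_eq]
  refine hasSum_integral_of_summable_integral_norm hint ?_
  have hnorm : ∀ y : {y // y ≠ x},
      ∫ t in Set.Ioi (0 : ℝ), ‖G.heatMatrix t x y * t ^ (-1 - s)‖ =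
        ∫ t in Set.Ioi (0 : ℝ), G.heatMatrix t x y * t ^ (-1 - s) := fun y =>
    setIntegral_congr_fun measurableSet_Ioi fun t ht => Real.norm_of_nonneg (hnn y t ht)
  simp_rw [hnorm]
  -- Finite partial sums of the integrals are dominated by the integral of the full off-diagonal
  -- mass.
  refine summable_of_sum_le
    (fun y => setIntegral_nonneg measurableSet_Ioi (hnn y))
    (c := ∫ t in Set.Ioi (0 : ℝ), (G.μ x - G.heatMatrix t x x) * t ^ (-1 - s)) fun S => ?_
  rw [← integral_finsetSum S fun y _ => hint y]
  exact setIntegral_mono_on (integrable_finsetSum S fun y _ => hint y) hint0 measurableSet_Ioi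
    fun t ht => sum_le_hasSum S (fun y _ => hnn y t ht) (htot t ht)

theorem tendsto_inv_Gamma_one_sub :
    Tendsto (fun s : ℝ => (Real.Gamma (1 - s))⁻¹) (𝓝[>] 0) (𝓝 1) := by
  have h1 : ContinuousAt Real.Gamma (1 - 0) :=
    (Real.differentiableAt_Gamma fun m => by
      have : (0 : ℝ) ≤ m := m.cast_nonneg
      linarith).continuousAt
  have h2 : ContinuousAt (fun s : ℝ => (Real.Gamma (1 - s))⁻¹) 0 :=
    (ContinuousAt.comp (f := fun s : ℝ => 1 - s) h1 (by fun_prop)).inv₀ (by simp)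
  have h3 := h2.tendsto
  simp only [sub_zero, Real.Gamma_one, inv_one] at h3
  exact h3.mono_left nhdsWithin_le_nhds

/-- The Abelian theorem with limit `L = 0`, by decay of the heat matrix. -/
theorem tendsto_fracWeight (hd : 0 < d) {x y : Fin d → ℤ} (hy : y ≠ x) :
    Tendsto (fun s : ℝ => G.fracWeight s x y) (𝓝[>] 0) (𝓝 0) := by
  simp_rw [fracWeight_eq]
  simpa using tendsto_inv_Gamma_one_sub.mul (tendsto_mul_integral_rpow_of_tendsto_atTop
    (G.continuous_heatMatrix x y).aestronglyMeasurable
    (fun _ ht => G.abs_heatMatrix_le ht.le hy) (G.tendsto_heatMatrix_atTop hd x y))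

/-- The Abelian theorem with `L = μ x`: at large times all the mass has left `x`. -/
theorem tendsto_tsum_fracWeight (hd : 0 < d) (x : Fin d → ℤ) :
    Tendsto (fun s : ℝ => ∑' y : {y // y ≠ x}, G.fracWeight s x y) (𝓝[>] 0) (𝓝 (G.μ x)) := by
  have h := tendsto_inv_Gamma_one_sub.mul (tendsto_mul_integral_rpow_of_tendsto_atTop
    (continuous_const.sub (G.continuous_heatMatrix x x)).aestronglyMeasurable
    (fun _ ht => G.abs_sub_heatMatrix_self_le ht.le x)
    (tendsto_const_nhds.sub (G.tendsto_heatMatrix_atTop hd x x)))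
  rw [sub_zero, one_mul] at h
  refine h.congr' ?_
  filter_upwards [Ioo_mem_nhdsGT (zero_lt_one (α := ℝ))] with s hs
  exact (G.hasSum_fracWeight hs x).tsum_eq.symm

/-- Finite support of `u` isolates the total weight times `u x`; the rest is a finite sum, so
termwise limits suffice. -/
theorem hasSum_fracWeight_mul_sub {s : ℝ} (hs : s ∈ Set.Ioo (0 : ℝ) 1)
    (u : (Fin d → ℤ) →₀ ℝ) (x : Fin d → ℤ) :
    HasSum (fun y : {y // y ≠ x} => G.fracWeight s x y * (u x - u y))
      ((∑' y : {y // y ≠ x}, G.fracWeight s x y) * u x -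
        ∑ y ∈ u.support.subtype (· ≠ x), G.fracWeight s x y * u y) := by
  simp_rw [mul_sub]
  refine ((G.hasSum_fracWeight hs x).summable.hasSum.mul_right _).sub
    (hasSum_sum_of_ne_finset_zero fun y hy => ?_)
  rw [Finset.mem_subtype, Finsupp.notMem_support_iff] at hy
  rw [hy, mul_zero]

theorem tendsto_fracLaplacianPointwise (hd : 0 < d) (u : (Fin d → ℤ) →₀ ℝ) (x : Fin d → ℤ) :
    Tendsto (fun s : ℝ => G.fracLaplacianPointwise s u x) (𝓝[>] 0) (𝓝 (u x)) := by
  have h1 : Tendsto (fun s : ℝ => ∑ y ∈ u.support.subtype (· ≠ x), G.fracWeight s x y * u y)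
      (𝓝[>] 0) (𝓝 0) := by
    simpa using tendsto_finsetSum (u.support.subtype (· ≠ x)) fun y _ =>
      (G.tendsto_fracWeight hd y.2).mul_const (u y)
  have h2 := (((G.tendsto_tsum_fracWeight hd x).mul_const (u x)).sub h1).const_mul (1 / G.μ x)
  rw [sub_zero, ← mul_assoc, one_div_mul_cancel (G.μ_pos x).ne', one_mul] at h2
  refine h2.congr' ?_
  filter_upwards [Ioo_mem_nhdsGT (zero_lt_one (α := ℝ))] with s hs
  rw [fracLaplacianPointwise, (G.hasSum_fracWeight_mul_sub hs u x).tsum_eq]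

/-- Evaluation at `x` is `(μ x)⁻¹` times the inner product with a point mass, hence continuous, so
strong convergence gives pointwise convergence for every `f` in `ℓ²`. -/
theorem tendsto_fracLaplacian_apply (hd : 0 < d) (f : G.L2) (x : Fin d → ℤ) :
    Tendsto (fun s : ℝ => (G.fracLaplacian s f : (Fin d → ℤ) → ℂ) x) (𝓝[>] 0) (𝓝 (f x)) := by
  have h := tendsto_functionOfOperator_rpow G.isSelfAdjoint_negLaplacian
    G.spectrum_negLaplacian_subset (G.negLaplacian_injective hd) f
  have h2 := (((innerSL ℂ (G.pointMass x)).continuous.tendsto f).comp h).const_mul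
    ((G.μ x : ℂ)⁻¹)
  have hμ : (G.μ x : ℂ) ≠ 0 := by exact_mod_cast (G.μ_pos x).ne'
  simpa only [fracLaplacian, Function.comp_def, innerSL_apply_apply, inner_pointMass, inv_mul_cancel_left₀ hμ]
    using h2

theorem toL2_apply (u : (Fin d → ℤ) →₀ ℝ) (x : Fin d → ℤ) :
    (G.toL2 u : (Fin d → ℤ) → ℂ) x = u x :=
  G.forall_of_ae (G.memLp_finsupp u).coeFn_toLp x

end WeightedLattice

theorem proposition1p7 {d : ℕ} (hd : 0 < d) (G : WeightedLattice d)
    (u : (Fin d → ℤ) →₀ ℝ) (x : Fin d → ℤ) :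
    Tendsto (fun s : ℝ => (G.fracLaplacian s (G.toL2 u) : (Fin d → ℤ) → ℂ) x)
      (𝓝[>] 0) (𝓝 (u x : ℂ)) ∧
    (∀ s ∈ Set.Ioo (0 : ℝ) 1,
      (∀ y, y ≠ x →
        IntegrableOn (fun t : ℝ => G.heatKernel t x y * t ^ (-1 - s)) (Set.Ioi 0)) ∧
      Summable fun y : {y // y ≠ x} => G.fracWeight s x y * (u x - u y)) ∧
    Tendsto (fun s : ℝ => G.fracLaplacianPointwise s u x) (𝓝[>] 0) (𝓝 (u x)) := by
  refine ⟨?_, fun s hs => ⟨fun y hy => G.integrableOn_heatKernel hs hy,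
    (G.hasSum_fracWeight_mul_sub hs u x).summable⟩, G.tendsto_fracLaplacianPointwise hd u x⟩
  rw [← G.toL2_apply u x]
  exact G.tendsto_fracLaplacian_apply hd (G.toL2 u) x
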